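/- Let $\mathfrak K$ be a separable complex Hilbert space with inner product $\langle\cdot|\cdot\rangle$ linear in the second variable, and let $U(\mathfrak K)$ be its unitary group with the strong operator topology. Let $\Gamma(\mathfrak K)=\bigoplus_{n\ge 0}\bigl(\otimes^n_{\mathrm{symm}}\mathfrak K\bigr)$ (Hilbert sum of the symmetric Hilbert space tensor powers) be the Bose Fock space, and for $f\in\mathfrak K$ let $\varepsilon(f)=1\oplus f\oplus\frac1{\sqrt{2!}}f\otimes f\oplus\frac1{\sqrt{3!}}f\otimes f\otimes f\oplus\cdots\in\Gamma(\mathfrak K)$ be the exponential vector of $f$. The Euclidean group $EU(\mathfrak K)$ consists of the pairs $(T,\phi)$, $T\in U(\mathfrak K)$, $\phi\in\mathfrak K$, with $(T_2,\phi_2)\circ(T_1,\phi_1)=(T_2T_1,\phi_2+T_2\phi_1)$. The extended Heisenberg group $\mathfrak G(\mathfrak K)$ is the set $EU(\mathfrak K)\times\mathbb R$ of triples $(T,\phi,\theta)$ with the product topology (strong operator topology on $U(\mathfrak K)$, norm topology on $\mathfrak K$, usual topology on $\mathbb R$) and the group law $$(T_2,\phi_2,\theta_2)\vartriangleleft(T_1,\phi_1,\theta_1)=\bigl(T_2T_1,\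 \phi_2+T_2\phi_1,\ \theta_1+\theta_2+\mathrm{Im}\langle\phi_2|T_2\phi_1\rangle\bigr).$$ **Proposition.** For each $(T,\phi,\theta)\in\mathfrak G(\mathfrak K)$ there is exactly one bounded linear operator $W(T,\phi,\theta)$ on $\Gamma(\mathfrak K)$ with $$W(T,\phi,\theta)\,\varepsilon(f)=e^{-i\theta}\exp\bigl\{-\tfrac12\|\phi\|^2-\langle\phi|Tf\rangle\bigr\}\,\varepsilon(Tf+\phi)\qquad\text{for all } f\in\mathfrak K .$$ This operator is unitary, and the map $W$ is a genuine (not merely projective) unitary representation of $\mathfrak G(\mathfrak K)$ on $\Gamma(\mathfrak K)$: $W(g_2\vartriangleleft g_1)=W(g_2)W(g_1)$ for all $g_1,g_2\in\mathfrak G(\mathfrak K)$, and $g\mapsto W(g)\psi$ is continuous for every $\psi\in\Gamma(\mathfrak K)$. -/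

import Mathlib

open scoped InnerProductSpace ComplexConjugate

noncomputable section

namespace BoseFock

/-! ### The inner product on algebraic tensor powers -/

section TensorPower

/-- The algebraic `n`-fold tensor power of `K`. -/
abbrev AlgTensor (n : ℕ) (K : Type*) [NormedAddCommGroup K] [InnerProductSpace ℂ K] :=
  PiTensorProduct ℂ (fun _ : Fin n => K)

variable {n : ℕ} {K : Type*} [NormedAddCommGroup K] [InnerProductSpace ℂ K]

/-- The conjugate linear functional `x₁ ⊗ ⋯ ⊗ xₙ ↦ ∏ i, ⟪xᵢ, yᵢ⟫`. -/
def tensorFunctional (y : Fin n → K) : AlgTensor n K →ₗ⋆[ℂ] ℂ :=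
  (starLinearEquiv ℂ : ℂ ≃ₗ⋆[ℂ] ℂ).toLinearMap.comp
    (PiTensorProduct.lift ((MultilinearMap.mkPiAlgebra ℂ (Fin n) ℂ).compLinearMap
      (fun i => (innerSL ℂ (y i) : K →L[ℂ] ℂ).toLinearMap)))

theorem tensorFunctional_tprod (y x : Fin n → K) :
    tensorFunctional y (PiTensorProduct.tprod ℂ x) = ∏ i, ⟪x i, y i⟫_ℂ := by
  simp [tensorFunctional]

theorem conjLinear_ext {f g : AlgTensor n K →ₗ⋆[ℂ] ℂ}
    (h : ∀ x : Fin n → K, f (PiTensorProduct.tprod ℂ x) = g (PiTensorProduct.tprod ℂ x)) :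
    f = g := by
  ext t
  induction t using PiTensorProduct.induction_on with
  | smul_tprod r x => simp [h]
  | add x y hx hy => simp [hx, hy]

/-- The form with `(x₁ ⊗ ⋯ ⊗ xₙ, y₁ ⊗ ⋯ ⊗ yₙ) ↦ ∏ i, ⟪xᵢ, yᵢ⟫`, written as `tensorForm y x`. -/
def tensorForm : AlgTensor n K →ₗ[ℂ] AlgTensor n K →ₗ⋆[ℂ] ℂ :=
  PiTensorProduct.lift
    { toFun := tensorFunctional
      map_update_add' := fun {d} m i a b => conjLinear_ext fun x => by
        obtain rfl : d = instDecidableEqFin n := Subsingleton.elim _ _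
        simp only [LinearMap.add_apply, tensorFunctional_tprod]
        rw [← Finset.mul_prod_erase _ _ (Finset.mem_univ i),
          ← Finset.mul_prod_erase _ _ (Finset.mem_univ i),
          ← Finset.mul_prod_erase _ _ (Finset.mem_univ i)]
        have e : ∀ c : K, ∏ j ∈ Finset.univ.erase i, ⟪x j, Function.update m i c j⟫_ℂ
            = ∏ j ∈ Finset.univ.erase i, ⟪x j, m j⟫_ℂ := fun c =>
          Finset.prod_congr rfl fun j hj => by
            rw [Function.update_of_ne (Finset.ne_of_mem_erase hj)]
        simp only [e, Function.update_self, inner_add_right, add_mul]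
      map_update_smul' := fun {d} m i r a => conjLinear_ext fun x => by
        obtain rfl : d = instDecidableEqFin n := Subsingleton.elim _ _
        simp only [LinearMap.smul_apply, tensorFunctional_tprod, smul_eq_mul]
        rw [← Finset.mul_prod_erase _ _ (Finset.mem_univ i),
          ← Finset.mul_prod_erase _ _ (Finset.mem_univ i)]
        have e : ∀ c : K, ∏ j ∈ Finset.univ.erase i, ⟪x j, Function.update m i c j⟫_ℂ
            = ∏ j ∈ Finset.univ.erase i, ⟪x j, m j⟫_ℂ := fun c =>
          Finset.prod_congr rfl fun j hj => by
            rw [Function.update_of_ne (Finset.ne_of_mem_erase hj)]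
        simp only [e, Function.update_self, inner_smul_right, mul_assoc] }

theorem tensorForm_tprod (y x : Fin n → K) :
    tensorForm (PiTensorProduct.tprod ℂ y) (PiTensorProduct.tprod ℂ x)
      = ∏ i, ⟪x i, y i⟫_ℂ := by
  simp [tensorForm, tensorFunctional_tprod]

theorem tensorForm_conj (x y : AlgTensor n K) :
    conj (tensorForm x y) = tensorForm y x := by
  induction x using PiTensorProduct.induction_on with
  | smul_tprod r a =>
    induction y using PiTensorProduct.induction_on with
    | smul_tprod s b =>
      simp only [map_smul, LinearMap.smul_apply, LinearMap.map_smulₛₗ, tensorForm_tprod,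
        smul_eq_mul, map_mul, map_prod, inner_conj_symm, Complex.conj_conj]
      ring
    | add y z hy hz => rw [map_add, map_add, hy, hz, map_add, LinearMap.add_apply]
  | add x z hx hz => simp [hx, hz]

/-- Every algebraic tensor is a finite combination of products of vectors of one finite
orthonormal family. -/
theorem exists_orthonormal_expansion (t : AlgTensor n K) :
    ∃ (m : ℕ) (e : Fin m → K) (c : (Fin n → Fin m) → ℂ), Orthonormal ℂ e ∧
      t = ∑ J, c J • PiTensorProduct.tprod ℂ (fun i => e (J i)) := by
  have h1 : ∃ V : Submodule ℂ K, FiniteDimensional ℂ V ∧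
      t ∈ Submodule.span ℂ
        {s : AlgTensor n K | ∃ v : Fin n → K, (∀ i, v i ∈ V) ∧ s = PiTensorProduct.tprod ℂ v} := by
    induction t using PiTensorProduct.induction_on with
    | smul_tprod r a =>
      refine ⟨Submodule.span ℂ (Set.range a),
        FiniteDimensional.span_of_finite ℂ (Set.finite_range a), Submodule.smul_mem _ _ ?_⟩
      exact Submodule.subset_span ⟨a, fun i => Submodule.subset_span ⟨i, rfl⟩, rfl⟩
    | add x y hx hy =>
      obtain ⟨V, hV, hxV⟩ := hx
      obtain ⟨U, hU, hyU⟩ := hy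
      refine ⟨V ⊔ U, inferInstance, Submodule.add_mem _ ?_ ?_⟩
      · refine Submodule.span_mono ?_ hxV
        rintro _ ⟨v, hv, rfl⟩
        exact ⟨v, fun i => Submodule.mem_sup_left (hv i), rfl⟩
      · refine Submodule.span_mono ?_ hyU
        rintro _ ⟨v, hv, rfl⟩
        exact ⟨v, fun i => Submodule.mem_sup_right (hv i), rfl⟩
  obtain ⟨V, hV, ht⟩ := h1
  let b := stdOrthonormalBasis ℂ V
  let e : Fin (Module.finrank ℂ V) → K := fun k => (b k : K)
  have he : Orthonormal ℂ e := b.orthonormal.comp_linearIsometry V.subtypeₗᵢ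
  have h2 : t ∈ Submodule.span ℂ (Set.range fun J : Fin n → Fin (Module.finrank ℂ V) =>
      (PiTensorProduct.tprod ℂ (fun i => e (J i)) : AlgTensor n K)) := by
    refine Submodule.span_le.2 ?_ ht
    rintro _ ⟨v, hv, rfl⟩
    have hv' : v = fun i => ∑ k, ⟪b k, (⟨v i, hv i⟩ : V)⟫_ℂ • e k := by
      funext i
      have := congrArg (fun w : V => (w : K)) (b.sum_repr' ⟨v i, hv i⟩)
      simpa [e] using this.symm
    rw [hv']
    classical
    rw [MultilinearMap.map_sum]
    refine Submodule.sum_mem _ fun J _ => ?_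
    rw [MultilinearMap.map_smul_univ]
    exact Submodule.smul_mem _ _ (Submodule.subset_span ⟨J, rfl⟩)
  obtain ⟨c, hc⟩ := (Submodule.mem_span_range_iff_exists_fun ℂ).1 h2
  exact ⟨_, e, c, he, hc.symm⟩

theorem tensorForm_self {m : ℕ} {e : Fin m → K} (he : Orthonormal ℂ e)
    (c : (Fin n → Fin m) → ℂ) :
    tensorForm (∑ J, c J • PiTensorProduct.tprod ℂ (fun i => e (J i)))
      (∑ J, c J • PiTensorProduct.tprod ℂ (fun i => e (J i)) : AlgTensor n K)
      = ((∑ J, ‖c J‖ ^ 2 : ℝ) : ℂ) := by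
  classical
  have key : ∀ J L : Fin n → Fin m,
      tensorForm (PiTensorProduct.tprod ℂ (fun i => e (J i)))
        (PiTensorProduct.tprod ℂ (fun i => e (L i)) : AlgTensor n K)
        = if L = J then 1 else 0 := by
    intro J L
    rw [tensorForm_tprod]
    simp only [orthonormal_iff_ite.1 he]
    split_ifs with h
    · subst h; simp
    · obtain ⟨i, hi⟩ := Function.ne_iff.1 h
      exact Finset.prod_eq_zero (Finset.mem_univ i) (by simp [hi])
  simp only [map_sum, LinearMap.sum_apply, map_smul, LinearMap.smul_apply,
    LinearMap.map_smulₛₗ, key, smul_eq_mul]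
  simp [Complex.conj_mul']

theorem tensorForm_self_nonneg (t : AlgTensor n K) : 0 ≤ (tensorForm t t).re := by
  obtain ⟨m, e, c, he, rfl⟩ := exists_orthonormal_expansion t
  rw [tensorForm_self he, Complex.ofReal_re]
  positivity

theorem tensorForm_definite (t : AlgTensor n K) (h : tensorForm t t = 0) : t = 0 := by
  obtain ⟨m, e, c, he, rfl⟩ := exists_orthonormal_expansion t
  rw [tensorForm_self he, Complex.ofReal_eq_zero,
    Finset.sum_eq_zero_iff_of_nonneg fun _ _ => sq_nonneg _] at h
  refine Finset.sum_eq_zero fun J hJ => ?_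
  have := h J hJ
  simp only [ne_eq, OfNat.ofNat_ne_zero, not_false_eq_true, pow_eq_zero_iff, norm_eq_zero] at this
  rw [this, zero_smul]

end TensorPower

/-! ### Symmetric tensors and Bose Fock space -/

section Fock

variable (n : ℕ) (K : Type*) [NormedAddCommGroup K] [InnerProductSpace ℂ K]

/-- The algebraic tensors of degree `n` that are fixed by all permutations of the factors. -/
def symmetricTensors : Submodule ℂ (AlgTensor n K) where
  carrier := {t | ∀ σ : Equiv.Perm (Fin n), PiTensorProduct.reindex ℂ (fun _ => K) σ t = t}
  add_mem' := fun ha hb σ => by rw [map_add, ha σ, hb σ]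
  zero_mem' := fun σ => map_zero _
  smul_mem' := fun c _ ha σ => by rw [map_smul, ha σ]

/-- The algebraic symmetric tensors of degree `n`, as a type that carries the Hilbert space
inner product `⟪x₁ ⊗ ⋯ ⊗ xₙ, y₁ ⊗ ⋯ ⊗ yₙ⟫ = ∏ i, ⟪xᵢ, yᵢ⟫` (and no other norm). -/
def AlgSym : Type _ := symmetricTensors n K

instance : AddCommGroup (AlgSym n K) := inferInstanceAs (AddCommGroup (symmetricTensors n K))

instance : Module ℂ (AlgSym n K) := inferInstanceAs (Module ℂ (symmetricTensors n K))

/-- The inclusion of the symmetric tensors into all tensors. -/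
def AlgSym.incl : AlgSym n K →ₗ[ℂ] AlgTensor n K := (symmetricTensors n K).subtype

@[reducible] def AlgSym.core : InnerProductSpace.Core ℂ (AlgSym n K) where
  inner x y := tensorForm (AlgSym.incl n K y) (AlgSym.incl n K x)
  conj_inner_symm x y := tensorForm_conj _ _
  re_inner_nonneg x := tensorForm_self_nonneg _
  add_left x y z := by simp
  smul_left x y r := by simp
  definite x h := Subtype.ext (tensorForm_definite _ h)

instance : NormedAddCommGroup (AlgSym n K) := (AlgSym.core n K).toNormedAddCommGroup

instance : InnerProductSpace ℂ (AlgSym n K) := .ofCore (AlgSym.core n K).toCore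

/-- The symmetric Hilbert space tensor power of degree `n`. -/
abbrev SymPower : Type _ := UniformSpace.Completion (AlgSym n K)

/-- Bose Fock space: the Hilbert sum of all symmetric tensor powers. -/
abbrev Fock : Type _ := lp (fun n : ℕ => SymPower n K) 2

end Fock

section Exponential

variable {K : Type*} [NormedAddCommGroup K] [InnerProductSpace ℂ K]

/-- The algebraic symmetric tensor `f ⊗ ⋯ ⊗ f` of degree `n`. -/
def algPow (n : ℕ) (f : K) : AlgSym n K :=
  ⟨PiTensorProduct.tprod ℂ (fun _ => f), fun σ => by rw [PiTensorProduct.reindex_tprod]⟩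

theorem inner_algPow (n : ℕ) (f g : K) :
    ⟪algPow n f, algPow n g⟫_ℂ = ⟪f, g⟫_ℂ ^ n := by
  change tensorForm (PiTensorProduct.tprod ℂ (fun _ : Fin n => g))
    (PiTensorProduct.tprod ℂ (fun _ : Fin n => f)) = _
  rw [tensorForm_tprod]
  simp

theorem norm_algPow (n : ℕ) (f : K) : ‖algPow n f‖ = ‖f‖ ^ n := by
  have h' : ‖algPow n f‖ ^ 2 = (‖f‖ ^ n) ^ 2 := by
    rw [@norm_sq_eq_re_inner ℂ, inner_algPow, inner_self_eq_norm_sq_to_K, ← pow_mul, mul_comm 2 n,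
      pow_mul]
    exact_mod_cast RCLike.ofReal_re (K := ℂ) _
  exact (pow_left_inj₀ (norm_nonneg _) (by positivity) two_ne_zero).1 h'

/-- The component `(n!)^{-1/2} f ⊗ ⋯ ⊗ f` of degree `n` of the exponential vector of `f`. -/
def expComponent (f : K) (n : ℕ) : SymPower n K :=
  (((Real.sqrt (Nat.factorial n : ℝ))⁻¹ : ℝ) : ℂ) • (algPow n f : SymPower n K)

theorem memℓp_expComponent (f : K) : Memℓp (expComponent f) 2 := by
  refine memℓp_gen ?_
  refine (Real.summable_pow_div_factorial (‖f‖ ^ 2)).congr fun n => ?_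
  rw [expComponent, norm_smul, UniformSpace.Completion.norm_coe, norm_algPow]
  simp only [ENNReal.toReal_ofNat, Real.rpow_ofNat, Complex.norm_real, norm_inv, mul_pow,
    inv_pow, Real.norm_eq_abs, sq_abs]
  rw [Real.sq_sqrt (by positivity)]
  ring

/-- The exponential vector `ε(f) = 1 ⊕ f ⊕ (2!)^{-1/2} f ⊗ f ⊕ (3!)^{-1/2} f ⊗ f ⊗ f ⊕ ⋯`. -/
def expVec (f : K) : Fock K := ⟨expComponent f, memℓp_expComponent f⟩

end Exponential

/-! ### The Euclidean group and the extended Heisenberg group -/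

section Groups

/-- The Euclidean group over `K`: pairs of a unitary `T` and a translation vector `φ`. -/
@[ext] structure EuclideanGroup (K : Type*) [NormedAddCommGroup K] [InnerProductSpace ℂ K] where
  T : K ≃ₗᵢ[ℂ] K
  φ : K

/-- The set `EU(K) × ℝ` underlying the extended Heisenberg group: triples `(T, φ, θ)`. -/
@[ext] structure ExtHeisenberg (K : Type*) [NormedAddCommGroup K] [InnerProductSpace ℂ K]
    extends EuclideanGroup K where
  θ : ℝ

variable {K : Type*} [NormedAddCommGroup K] [InnerProductSpace ℂ K]

/-- `(T₂, φ₂) ∘ (T₁, φ₁) = (T₂ T₁, φ₂ + T₂ φ₁)`. -/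
instance : Group (EuclideanGroup K) where
  mul b a := ⟨b.T * a.T, b.φ + b.T a.φ⟩
  one := ⟨1, 0⟩
  inv a := ⟨a.T⁻¹, -(a.T⁻¹ a.φ)⟩
  mul_assoc c b a := EuclideanGroup.ext (mul_assoc _ _ _) (by
    change c.φ + c.T b.φ + c.T (b.T a.φ) = c.φ + c.T (b.φ + b.T a.φ)
    rw [map_add, add_assoc])
  one_mul a := EuclideanGroup.ext (one_mul _) (zero_add _)
  mul_one a := EuclideanGroup.ext (mul_one _) (by
    change a.φ + a.T 0 = a.φ
    rw [map_zero, add_zero])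
  inv_mul_cancel a := EuclideanGroup.ext (inv_mul_cancel _) (neg_add_cancel _)

/-- `(T₂, φ₂, θ₂) (T₁, φ₁, θ₁) = (T₂ T₁, φ₂ + T₂ φ₁, θ₁ + θ₂ + Im ⟪φ₂, T₂ φ₁⟫)`. -/
instance : Group (ExtHeisenberg K) where
  mul b a := ⟨b.toEuclideanGroup * a.toEuclideanGroup, a.θ + b.θ + (⟪b.φ, b.T a.φ⟫_ℂ).im⟩
  one := ⟨1, 0⟩
  inv a := ⟨a.toEuclideanGroup⁻¹, -a.θ⟩
  mul_assoc c b a := ExtHeisenberg.ext (congrArg (·.T) (mul_assoc _ _ _ :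
      c.toEuclideanGroup * b.toEuclideanGroup * a.toEuclideanGroup = _))
      (congrArg (·.φ) (mul_assoc _ _ _ :
      c.toEuclideanGroup * b.toEuclideanGroup * a.toEuclideanGroup = _)) (by
    change a.θ + (b.θ + c.θ + (⟪c.φ, c.T b.φ⟫_ℂ).im) + (⟪c.φ + c.T b.φ, c.T (b.T a.φ)⟫_ℂ).im
      = a.θ + b.θ + (⟪b.φ, b.T a.φ⟫_ℂ).im + c.θ + (⟪c.φ, c.T (b.φ + b.T a.φ)⟫_ℂ).im
    rw [map_add, inner_add_left, inner_add_right, LinearIsometryEquiv.inner_map_map,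
      Complex.add_im, Complex.add_im]
    ring)
  one_mul a := ExtHeisenberg.ext (one_mul a.T) (zero_add a.φ) (by
    change a.θ + 0 + (⟪(0 : K), a.φ⟫_ℂ).im = a.θ
    simp)
  mul_one a := ExtHeisenberg.ext (mul_one a.T)
    (congrArg (·.φ) (mul_one a.toEuclideanGroup)) (by
    change 0 + a.θ + (⟪a.φ, a.T 0⟫_ℂ).im = a.θ
    simp)
  inv_mul_cancel a := ExtHeisenberg.ext (inv_mul_cancel a.T)
    (congrArg (·.φ) (inv_mul_cancel a.toEuclideanGroup)) (by
    change a.θ + -a.θ + (⟪-(a.T⁻¹ a.φ), a.T⁻¹ a.φ⟫_ℂ).im = 0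
    rw [inner_neg_left, Complex.neg_im, ← RCLike.im_eq_complex_im, inner_self_im]
    ring)

/-- Strong operator topology on the unitary part, norm topology on the translation part. -/
instance : TopologicalSpace (EuclideanGroup K) :=
  .induced (fun a => ((fun x => a.T x : K → K), a.φ)) inferInstance

/-- The product topology of `EU(K) × ℝ`. -/
instance : TopologicalSpace (ExtHeisenberg K) :=
  .induced (fun a => (a.toEuclideanGroup, a.θ)) inferInstance

end Groups

end BoseFock

end

/-! Everything reduces to exponential vectors, through the Gram identity ⟪ε(f), ε(h)⟫ = exp ⟪f, h⟫
(`inner_expVec`) and totality (`dense_span_expVec`). For totality, a vector orthogonal to every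
ε(zf), z ∈ ℂ, is orthogonal to every f ⊗ ⋯ ⊗ f by comparing coefficients in z, and by polarization
these powers span the symmetric tensors.

The prescribed images `weylVec g f` have the Gram matrix of the ε(f) (`inner_weylVec`) and are again
total, so a unitary carries one family to the other; totality also makes it the only bounded
operator doing so. Multiplicativity is then an identity of exponents on exponential vectors
(`weyl_weylVec`), in which the Im term of the group law absorbs the projective phase. Since the
operators are isometries, strong continuity too needs checking only on exponential vectors, where it
follows from continuity of ε. -/

namespace BoseFock

/-! ### Polarization: symmetric tensors are spanned by powers -/

section Polarization

variable {n : ℕ} {K : Type*} [NormedAddCommGroup K] [InnerProductSpace ℂ K]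

/-- The polarization identity for the symmetrization of a pure tensor. -/
theorem sum_perm_tprod (x : Fin n → K) :
    ∑ σ : Equiv.Perm (Fin n), (PiTensorProduct.tprod ℂ (fun i => x (σ i)) : AlgTensor n K)
      = ∑ S : Finset (Fin n), ((-1 : ℂ) ^ (Sᶜ).card) •
          PiTensorProduct.tprod ℂ (fun _ => ∑ i ∈ S, x i) := by
  classical
  have h1 : ∀ S : Finset (Fin n),
      (PiTensorProduct.tprod ℂ (fun _ => ∑ i ∈ S, x i) : AlgTensor n K)
        = ∑ J : Fin n → Fin n, if Sᶜ ⊆ (Finset.univ.image J)ᶜ then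
            PiTensorProduct.tprod ℂ (fun i => x (J i)) else 0 := by
    intro S
    rw [(PiTensorProduct.tprod ℂ).map_sum_finset (fun _ j => x j) (fun _ => S),
      ← Finset.sum_filter]
    refine Finset.sum_congr ?_ fun _ _ => rfl
    ext J
    simp [Finset.image_subset_iff]
  -- Inclusion-exclusion: the sets Sᶜ range over all subsets of the complement of the image of J, so
  -- the alternating sum vanishes unless J is onto, that is, a permutation.
  have h2 : ∀ J : Fin n → Fin n,
      ∑ S : Finset (Fin n), (if Sᶜ ⊆ (Finset.univ.image J)ᶜ then (-1 : ℂ) ^ (Sᶜ).card else 0)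
        = if Function.Bijective J then 1 else 0 := by
    intro J
    have h3 := congrArg (Int.cast : ℤ → ℂ)
      (Finset.sum_powerset_neg_one_pow_card (x := (Finset.univ.image J)ᶜ))
    refine (Equiv.sum_comp (compl_involutive (α := Finset (Fin n))).toPerm
      (fun S => if S ⊆ (Finset.univ.image J)ᶜ then (-1 : ℂ) ^ S.card else 0)).trans ?_
    rw [← Finset.sum_filter]
    have h4 : Finset.univ.filter (fun S => S ⊆ (Finset.univ.image J)ᶜ)
        = ((Finset.univ.image J)ᶜ).powerset := by ext; simp
    rw [h4]
    push_cast at h3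
    rw [h3]
    refine if_congr ?_ rfl rfl
    rw [Finset.compl_eq_empty_iff, ← Finite.surjective_iff_bijective,
      Finset.eq_univ_iff_forall]
    simp [Function.Surjective]
  simp only [h1, Finset.smul_sum]
  rw [Finset.sum_comm]
  have h5 : ∀ J : Fin n → Fin n, ∑ S : Finset (Fin n), ((-1 : ℂ) ^ (Sᶜ).card) •
      (if Sᶜ ⊆ (Finset.univ.image J)ᶜ then
        (PiTensorProduct.tprod ℂ (fun i => x (J i)) : AlgTensor n K) else 0)
      = if Function.Bijective J then PiTensorProduct.tprod ℂ (fun i => x (J i)) else 0 := by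
    intro J
    have := congrArg (· • (PiTensorProduct.tprod ℂ (fun i => x (J i)) : AlgTensor n K)) (h2 J)
    simpa only [Finset.sum_smul, ite_smul, zero_smul, one_smul, smul_ite, smul_zero] using this
  simp only [h5]
  rw [← Finset.sum_filter]
  refine Finset.sum_bij (fun σ _ => (σ : Fin n → Fin n)) ?_ ?_ ?_ ?_
  · intro σ _; exact Finset.mem_filter.2 ⟨Finset.mem_univ _, σ.bijective⟩
  · intro σ _ τ _ h; exact DFunLike.coe_injective h
  · intro J hJ
    exact ⟨Equiv.ofBijective J (Finset.mem_filter.1 hJ).2, Finset.mem_univ _, rfl⟩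
  · intro _ _; rfl

theorem sum_reindex_mem_span (t : AlgTensor n K) :
    ∑ σ : Equiv.Perm (Fin n), PiTensorProduct.reindex ℂ (fun _ => K) σ t ∈
      Submodule.span ℂ (Set.range fun f : K =>
        (PiTensorProduct.tprod ℂ (fun _ : Fin n => f) : AlgTensor n K)) := by
  induction t using PiTensorProduct.induction_on with
  | smul_tprod r x =>
    simp only [map_smul, ← Finset.smul_sum]
    refine Submodule.smul_mem _ _ ?_
    have h : ∑ σ : Equiv.Perm (Fin n), PiTensorProduct.reindex ℂ (fun _ => K) σ
        (PiTensorProduct.tprod ℂ x)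
        = ∑ σ : Equiv.Perm (Fin n), (PiTensorProduct.tprod ℂ (fun i => x (σ i)) : AlgTensor n K) := by
      -- Reindexing by σ moves the factors by σ⁻¹, so the sum is taken over inverses.
      rw [← Equiv.sum_comp (Equiv.inv (Equiv.Perm (Fin n)))]
      refine Finset.sum_congr rfl fun σ _ => ?_
      rw [PiTensorProduct.reindex_tprod]
      rfl
    rw [h, sum_perm_tprod]
    exact Submodule.sum_mem _ fun S _ => Submodule.smul_mem _ _ (Submodule.subset_span ⟨_, rfl⟩)
  | add x y hx hy =>
    simp only [map_add, Finset.sum_add_distrib]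
    exact Submodule.add_mem _ hx hy

/-- Summing over all permutations multiplies a symmetric tensor by n!, which is invertible in ℂ, so
`sum_reindex_mem_span` reaches the tensor itself. -/
theorem span_range_algPow : Submodule.span ℂ (Set.range (algPow n : K → AlgSym n K)) = ⊤ := by
  refine eq_top_iff.2 fun t _ => ?_
  have h : AlgSym.incl n K t ∈ (Submodule.span ℂ (Set.range (algPow n : K → AlgSym n K))).map
      (AlgSym.incl n K) := by
    rw [Submodule.map_span, ← Set.range_comp]
    have h1 := sum_reindex_mem_span (AlgSym.incl n K t)
    have h2 : ∀ σ : Equiv.Perm (Fin n), PiTensorProduct.reindex ℂ (fun _ => K) σ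
        (AlgSym.incl n K t) = AlgSym.incl n K t := t.2
    simp only [h2] at h1
    rw [Finset.sum_const, ← Nat.cast_smul_eq_nsmul ℂ] at h1
    exact (Submodule.smul_mem_iff _ (by simp [Fintype.card_ne_zero])).1 h1
  obtain ⟨s, hs, hst⟩ := h
  rwa [← show s = t from Subtype.ext hst]

end Polarization

/-! ### Exponential vectors -/

section Total

variable {K : Type*} [NormedAddCommGroup K] [InnerProductSpace ℂ K]

theorem inner_expVec (f g : K) : ⟪expVec f, expVec g⟫_ℂ = Complex.exp ⟪f, g⟫_ℂ := by
  have h := lp.hasSum_inner (𝕜 := ℂ) (expVec f) (expVec g)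
  have h' := NormedSpace.expSeries_div_hasSum_exp (𝔸 := ℂ) ⟪f, g⟫_ℂ
  rw [← Complex.exp_eq_exp_ℂ] at h'
  refine h.unique (h'.congr_fun fun n => ?_)
  change ⟪expComponent f n, expComponent g n⟫_ℂ = _
  rw [expComponent, expComponent, inner_smul_left, inner_smul_right,
    UniformSpace.Completion.inner_coe, inner_algPow, Complex.conj_ofReal, ← mul_assoc,
    ← Complex.ofReal_mul, ← mul_inv, Real.mul_self_sqrt (by positivity)]
  push_cast
  ring

theorem algPow_smul (n : ℕ) (z : ℂ) (f : K) : algPow n (z • f) = z ^ n • algPow n f :=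
  Subtype.ext (by
    change PiTensorProduct.tprod ℂ (fun _ : Fin n => z • f)
      = z ^ n • PiTensorProduct.tprod ℂ (fun _ : Fin n => f)
    rw [MultilinearMap.map_smul_univ]
    simp)

/-- The function z ↦ ⟪ψ, ε(zf)⟫ is a power series in z whose n-th coefficient is the wanted inner
product divided by √(n!); it is identically zero, hence so are its coefficients. -/
theorem inner_algPow_eq_zero {ψ : Fock K} (h : ∀ f : K, ⟪ψ, expVec f⟫_ℂ = 0) (n : ℕ) (f : K) :
    ⟪ψ n, (algPow n f : SymPower n K)⟫_ℂ = 0 := by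
  let c : ℕ → ℂ := fun n => ⟪ψ n, expComponent f n⟫_ℂ
  have hc : HasFPowerSeriesAt (0 : ℂ → ℂ) (FormalMultilinearSeries.ofScalars ℂ c) 0 := by
    rw [hasFPowerSeriesAt_iff]
    refine Filter.Eventually.of_forall fun z => ?_
    have hs := lp.hasSum_inner (𝕜 := ℂ) ψ (expVec (z • f))
    rw [h] at hs
    refine hs.congr_fun fun n => ?_
    change _ = ⟪ψ n, expComponent (z • f) n⟫_ℂ
    rw [FormalMultilinearSeries.coeff_ofScalars]
    simp only [c, expComponent, algPow_smul, UniformSpace.Completion.coe_smul, inner_smul_right,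
      smul_eq_mul]
    ring
  have h0 := congrArg (fun p => FormalMultilinearSeries.coeff p n) hc.eq_zero
  simp only [FormalMultilinearSeries.coeff_ofScalars, c, expComponent, inner_smul_right] at h0
  refine (mul_eq_zero.1 (h0.trans ?_)).resolve_left ?_
  · simp [FormalMultilinearSeries.coeff]
  · have : Real.sqrt (n.factorial : ℝ) ≠ 0 := by positivity
    simpa using this

/-- The exponential vectors are total in Fock space. -/
theorem dense_span_expVec :
    Dense (Submodule.span ℂ (Set.range (expVec : K → Fock K)) : Set (Fock K)) := by
  rw [Submodule.dense_iff_topologicalClosure_eq_top, Submodule.topologicalClosure_eq_top_iff,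
    Submodule.eq_bot_iff]
  intro ψ hψ
  have h : ∀ f : K, ⟪ψ, expVec f⟫_ℂ = 0 := fun f =>
    (Submodule.mem_orthogonal' _ _).1 hψ _ (Submodule.subset_span ⟨f, rfl⟩)
  refine lp.ext (funext fun n => ?_)
  have h1 : ∀ t : AlgSym n K, ⟪ψ n, (t : SymPower n K)⟫_ℂ = 0 := by
    intro t
    have ht : t ∈ Submodule.span ℂ (Set.range (algPow n : K → AlgSym n K)) := by
      rw [span_range_algPow]; trivial
    induction ht using Submodule.span_induction with
    | mem _ hx => obtain ⟨f, rfl⟩ := hx; exact inner_algPow_eq_zero h n f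
    | zero => rw [UniformSpace.Completion.coe_zero, inner_zero_right]
    | add x y _ _ hx hy => rw [UniformSpace.Completion.coe_add, inner_add_right, hx, hy, add_zero]
    | smul a x _ hx => rw [UniformSpace.Completion.coe_smul, inner_smul_right, hx, mul_zero]
  have h2 : ∀ x : SymPower n K, ⟪ψ n, x⟫_ℂ = 0 := fun x =>
    UniformSpace.Completion.induction_on x
      (isClosed_eq (continuous_const.inner continuous_id) continuous_const) h1
  exact inner_self_eq_zero.1 (h2 (ψ n))

theorem continuous_expVec : Continuous (expVec : K → Fock K) := by
  refine continuous_iff_continuousAt.2 fun f => ?_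
  rw [ContinuousAt, tendsto_iff_norm_sub_tendsto_zero]
  -- The Gram identity turns the distance into an explicit continuous function of g that vanishes at
  -- f.
  have h : ∀ g : K, ‖expVec g - expVec f‖ = Real.sqrt
      (Complex.exp ⟪g, g⟫_ℂ - Complex.exp ⟪g, f⟫_ℂ - Complex.exp ⟪f, g⟫_ℂ
        + Complex.exp ⟪f, f⟫_ℂ).re := by
    intro g
    rw [@norm_eq_sqrt_re_inner ℂ, inner_sub_sub_self]
    simp only [inner_expVec]
    rfl
  simp only [h]
  have hc : Continuous fun g : K => Real.sqrt
      (Complex.exp ⟪g, g⟫_ℂ - Complex.exp ⟪g, f⟫_ℂ - Complex.exp ⟪f, g⟫_ℂ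
        + Complex.exp ⟪f, f⟫_ℂ).re := by fun_prop
  simpa using hc.tendsto f

end Total

/-! ### Isometries determined by total families -/

section TotalFamily

variable {ι H : Type*} [NormedAddCommGroup H] [InnerProductSpace ℂ H]

theorem denseRange_linearCombination {v : ι → H}
    (hv : Dense (Submodule.span ℂ (Set.range v) : Set H)) :
    DenseRange (Finsupp.linearCombination ℂ v) := by
  rwa [DenseRange, ← LinearMap.coe_range, Finsupp.range_linearCombination]

theorem norm_linearCombination_eq {v w : ι → H} (h : ∀ i j, ⟪w i, w j⟫_ℂ = ⟪v i, v j⟫_ℂ)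
    (c : ι →₀ ℂ) : ‖Finsupp.linearCombination ℂ w c‖ = ‖Finsupp.linearCombination ℂ v c‖ := by
  rw [@norm_eq_sqrt_re_inner ℂ, @norm_eq_sqrt_re_inner ℂ]
  simp only [Finsupp.linearCombination_apply, Finsupp.sum, sum_inner, inner_sum, inner_smul_left,
    inner_smul_right, h]

/-- Two total families with the same Gram matrix are related by a unitary. -/
theorem exists_linearIsometryEquiv [CompleteSpace H] {v w : ι → H}
    (hv : Dense (Submodule.span ℂ (Set.range v) : Set H))
    (hw : Dense (Submodule.span ℂ (Set.range w) : Set H))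
    (h : ∀ i j, ⟪w i, w j⟫_ℂ = ⟪v i, v j⟫_ℂ) : ∃ U : H ≃ₗᵢ[ℂ] H, ∀ i, U (v i) = w i := by
  refine ⟨(LinearEquiv.refl ℂ (ι →₀ ℂ)).extendOfIsometry (Finsupp.linearCombination ℂ v)
    (Finsupp.linearCombination ℂ w) (denseRange_linearCombination hv)
    (denseRange_linearCombination hw) (norm_linearCombination_eq h), fun i => ?_⟩
  have := LinearEquiv.extendOfIsometry_eq (LinearEquiv.refl ℂ (ι →₀ ℂ))
    (Finsupp.linearCombination ℂ v) (Finsupp.linearCombination ℂ w)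
    (denseRange_linearCombination hv)
    (denseRange_linearCombination hw) (norm_linearCombination_eq h) (Finsupp.single i 1)
  simpa using this

theorem eq_of_eq_on_total {v : ι → H} (hv : Dense (Submodule.span ℂ (Set.range v) : Set H))
    {A B : H →L[ℂ] H} (h : ∀ i, A (v i) = B (v i)) : A = B :=
  ContinuousLinearMap.ext_on hv (by rintro _ ⟨i, rfl⟩; exact h i)

/-- Strong continuity of a family of isometries can be tested on a total family. -/
theorem continuous_of_continuous_on_total {X : Type*} [TopologicalSpace X] {v : ι → H}
    (hv : Dense (Submodule.span ℂ (Set.range v) : Set H)) (U : X → H ≃ₗᵢ[ℂ] H)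
    (h : ∀ i, Continuous fun x => U x (v i)) (ψ : H) : Continuous fun x => U x ψ := by
  have hspan : ∀ ψ ∈ Submodule.span ℂ (Set.range v), Continuous fun x => U x ψ := by
    intro ψ hψ
    induction hψ using Submodule.span_induction with
    | mem _ hx => obtain ⟨i, rfl⟩ := hx; exact h i
    | zero => simpa using continuous_const
    | add x y _ _ hx hy => simpa only [map_add] using! hx.add hy
    | smul a x _ hx => simpa only [map_smul] using! hx.const_smul a
  refine continuous_of_uniform_approx_of_continuous fun u hu => ?_
  obtain ⟨ε, hε, hεu⟩ := Metric.mem_uniformity_dist.1 hu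
  obtain ⟨χ, hχ, hd⟩ := Metric.mem_closure_iff.1 (hv ψ) ε hε
  -- The approximation is uniform in x because every `U x` preserves the distance from ψ to χ.
  refine ⟨fun x => U x χ, hspan χ hχ, fun x => hεu ?_⟩
  rwa [(U x).dist_map]

end TotalFamily

/-! ### The representation -/

section Weyl

variable {K : Type*} [NormedAddCommGroup K] [InnerProductSpace ℂ K]

/-- The image `W(g) ε(f)` of an exponential vector under the Weyl operator of `g`. -/
noncomputable def weylVec (g : ExtHeisenberg K) (f : K) : Fock K :=
  Complex.exp (-Complex.I * (g.θ : ℂ)) •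
    Complex.exp (-(1 / 2 : ℂ) * (‖g.φ‖ : ℂ) ^ 2 - ⟪g.φ, g.T f⟫_ℂ) • expVec (g.T f + g.φ)

/-- The phase in θ has modulus one, and the prefactors cancel the three terms containing φ in ⟪Tf +
φ, Th + φ⟫, leaving ⟪f, h⟫. -/
theorem inner_weylVec (g : ExtHeisenberg K) (f h : K) :
    ⟪weylVec g f, weylVec g h⟫_ℂ = ⟪expVec f, expVec h⟫_ℂ := by
  have e : ⟪g.φ, g.φ⟫_ℂ = (‖g.φ‖ : ℂ) ^ 2 := inner_self_eq_norm_sq_to_K _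
  simp only [weylVec, inner_smul_left, inner_smul_right, inner_expVec, ← Complex.exp_conj,
    ← Complex.exp_add]
  congr 1
  simp only [map_mul, map_sub, map_neg, map_pow, map_div₀, map_one, map_ofNat, Complex.conj_I,
    Complex.conj_ofReal, inner_conj_symm, inner_add_left, inner_add_right,
    LinearIsometryEquiv.inner_map_map, e]
  ring

theorem dense_span_weylVec (g : ExtHeisenberg K) :
    Dense (Submodule.span ℂ (Set.range (weylVec g)) : Set (Fock K)) := by
  refine dense_span_expVec.mono (SetLike.coe_subset_coe.2 (Submodule.span_le.2 ?_))
  rintro _ ⟨h, rfl⟩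
  -- The argument solves Tf + φ = h, so this vector is a nonzero multiple of ε(h).
  have hm : weylVec g (g.T.symm (h - g.φ)) ∈ Submodule.span ℂ (Set.range (weylVec g)) :=
    Submodule.subset_span ⟨_, rfl⟩
  rw [weylVec, Submodule.smul_mem_iff _ (Complex.exp_ne_zero _),
    Submodule.smul_mem_iff _ (Complex.exp_ne_zero _)] at hm
  simpa using hm

/-- The Weyl operator `W(T, φ, θ)`. -/
noncomputable def weyl (g : ExtHeisenberg K) : Fock K ≃ₗᵢ[ℂ] Fock K :=
  (exists_linearIsometryEquiv dense_span_expVec (dense_span_weylVec g) (inner_weylVec g)).choose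

theorem weyl_expVec (g : ExtHeisenberg K) (f : K) : weyl g (expVec f) = weylVec g f :=
  (exists_linearIsometryEquiv dense_span_expVec (dense_span_weylVec g)
    (inner_weylVec g)).choose_spec f

theorem eq_weyl (g : ExtHeisenberg K) (V : Fock K →L[ℂ] Fock K)
    (hV : ∀ f : K, V (expVec f) = weylVec g f) (ψ : Fock K) : V ψ = weyl g ψ :=
  DFunLike.congr_fun (eq_of_eq_on_total dense_span_expVec
    (B := ((weyl g).toContinuousLinearEquiv : Fock K →L[ℂ] Fock K))
    fun f => (hV f).trans (weyl_expVec g f).symm) ψ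

theorem weyl_weylVec (b a : ExtHeisenberg K) (f : K) :
    weyl b (weylVec a f) = weylVec (b * a) f := by
  have hT : (b * a).T f = b.T (a.T f) := rfl
  have hφ : (b * a).φ = b.φ + b.T a.φ := rfl
  have hθ : (b * a).θ = a.θ + b.θ + (⟪b.φ, b.T a.φ⟫_ℂ).im := rfl
  have hn : (‖b.φ + b.T a.φ‖ : ℂ) ^ 2
      = (‖b.φ‖ : ℂ) ^ 2 + 2 * ((⟪b.φ, b.T a.φ⟫_ℂ).re : ℂ) + (‖a.φ‖ : ℂ) ^ 2 := by
    have := @norm_add_sq ℂ _ _ _ _ b.φ (b.T a.φ)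
    rw [LinearIsometryEquiv.norm_map] at this
    exact_mod_cast this
  rw [weylVec, map_smul, map_smul, weyl_expVec, weylVec, weylVec, hT, hφ, hθ, hn, map_add]
  simp only [smul_smul, ← Complex.exp_add]
  refine congrArg₂ (· • ·) (congrArg Complex.exp ?_) (congrArg expVec ?_)
  · simp only [inner_add_left, inner_add_right, LinearIsometryEquiv.inner_map_map]
    -- The real part of the cross term completes ‖φ₂ + T₂φ₁‖², and its imaginary part is the shift
    -- of θ in the group law.
    conv_lhs => rw [← Complex.re_add_im ⟪b.φ, b.T a.φ⟫_ℂ]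
    push_cast
    ring
  · abel

theorem weyl_mul (b a : ExtHeisenberg K) : weyl (b * a) = weyl b * weyl a := by
  refine LinearIsometryEquiv.ext fun ψ => (eq_weyl (b * a)
    (((weyl a).trans (weyl b)).toContinuousLinearEquiv : Fock K →L[ℂ] Fock K) (fun f => ?_) ψ).symm
  change weyl b (weyl a (expVec f)) = _
  rw [weyl_expVec, weyl_weylVec]

theorem continuous_toEuclideanGroup :
    Continuous (fun g : ExtHeisenberg K => g.toEuclideanGroup) :=
  continuous_fst.comp
    (continuous_induced_dom (f := fun a : ExtHeisenberg K => (a.toEuclideanGroup, a.θ)))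

theorem continuous_θ : Continuous (fun g : ExtHeisenberg K => g.θ) :=
  continuous_snd.comp
    (continuous_induced_dom (f := fun a : ExtHeisenberg K => (a.toEuclideanGroup, a.θ)))

theorem continuous_T_φ :
    Continuous (fun g : ExtHeisenberg K => ((fun x => g.T x : K → K), g.φ)) :=
  (continuous_induced_dom (f := fun a : EuclideanGroup K => ((fun x => a.T x : K → K), a.φ))).comp
    continuous_toEuclideanGroup

theorem continuous_weylVec (f : K) : Continuous fun g : ExtHeisenberg K => weylVec g f := by
  have hθ := continuous_θ (K := K)
  have hT : Continuous fun g : ExtHeisenberg K => g.T f :=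
    (continuous_apply f).comp (continuous_fst.comp continuous_T_φ)
  have hφ : Continuous fun g : ExtHeisenberg K => g.φ := continuous_snd.comp continuous_T_φ
  have h1 : Continuous fun g : ExtHeisenberg K => Complex.exp (-Complex.I * (g.θ : ℂ)) := by
    fun_prop
  have h2 : Continuous fun g : ExtHeisenberg K =>
      Complex.exp (-(1 / 2 : ℂ) * (‖g.φ‖ : ℂ) ^ 2 - ⟪g.φ, g.T f⟫_ℂ) := by fun_prop
  exact h1.smul (h2.smul (continuous_expVec.comp (hT.add hφ)))

end Weyl

end BoseFock

theorem mainTheorem4 {K : Type*} [NormedAddCommGroup K] [InnerProductSpace ℂ K] [CompleteSpace K]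
    [TopologicalSpace.SeparableSpace K] :
    ∃ W : BoseFock.ExtHeisenberg K →* (BoseFock.Fock K ≃ₗᵢ[ℂ] BoseFock.Fock K),
      (∀ (g : BoseFock.ExtHeisenberg K) (f : K),
        W g (BoseFock.expVec f) =
          Complex.exp (-Complex.I * (g.θ : ℂ)) •
            Complex.exp (-(1 / 2 : ℂ) * (‖g.φ‖ : ℂ) ^ 2 - ⟪g.φ, g.T f⟫_ℂ) •
              BoseFock.expVec (g.T f + g.φ)) ∧
      (∀ (g : BoseFock.ExtHeisenberg K) (V : BoseFock.Fock K →L[ℂ] BoseFock.Fock K),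
        (∀ f : K, V (BoseFock.expVec f) =
          Complex.exp (-Complex.I * (g.θ : ℂ)) •
            Complex.exp (-(1 / 2 : ℂ) * (‖g.φ‖ : ℂ) ^ 2 - ⟪g.φ, g.T f⟫_ℂ) •
              BoseFock.expVec (g.T f + g.φ)) →
        ∀ ψ : BoseFock.Fock K, V ψ = W g ψ) ∧
      ∀ ψ : BoseFock.Fock K, Continuous fun g : BoseFock.ExtHeisenberg K => W g ψ := by
  -- Multiplicativity alone suffices for a homomorphism, as the unitaries form a group.
  refine ⟨MonoidHom.mk' BoseFock.weyl BoseFock.weyl_mul, BoseFock.weyl_expVec, BoseFock.eq_weyl,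
    BoseFock.continuous_of_continuous_on_total BoseFock.dense_span_expVec BoseFock.weyl fun f => ?_⟩
  simpa only [BoseFock.weyl_expVec] using BoseFock.continuous_weylVec f
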